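/- Let $\mathcal A$ be a finite set of actions and let $\mathcal M(\mathcal A)$ be the set of probability distributions on $\mathcal A$. A task $T=(\mathcal A,\rho)$ consists of a reward distribution $\rho(\cdot\mid a)$ on $[0,1]$ for every $a\in\mathcal A$. Tasks $T_1,T_2,\dots$, with $T_i=(\mathcal A,\rho_i)$, are drawn i.i.d. from an environment $\mathcal T$. Fix $n,m\ge 1$. In task $i$ a data set $D_i=\{(a_{ij},r_{ij})\}_{j=1}^m$ is collected with $$a_{ij}\sim b_{ij}(\cdot\mid D_1,\dots,D_{i-1},D_i^{:j-1}),\qquad r_{ij}\sim\rho_i(\cdot\mid a_{ij}),$$ where $D_i^{:j}$ denotes the first $j$ pairs of $D_i$ and the behaviour policies $b_{ij}$ are (measurable) functions of the previous data with values in $\mathcal M(\mathcal A)$; write $b_{ij}(a)$ for the resulting probability of the action $a$. A deterministic (measurable) base learning algorithm $A$ maps a data set $D$ and a prior $P\in\mathcal M(\mathcal A)$ to a posterior $A(D,P)\in\mathcal M(\mathcal A)$. Put $R_i(a)=\mathbb E_{r\sim\rho_i(\cdot\mid a)}[r]$ and $$\widehat R_i^{\tau}(a,D_i)=\frac1m\sum_{j=1}^m\min\Big(\frac1{b_{ij}(a_{ij})},1+\tau\Big)r_{ij}\mathbb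 I\{a_{ij}=a\},$$ and, for $Q\in\mathcal M(\mathcal A)$, let $R_i(Q)$ and $\widehat R_i^\tau(Q,D_i)$ be the expectations of $R_i(a)$ and $\widehat R_i^\tau(a,D_i)$ for $a\sim Q$. For a probability distribution $\mathcal Q$ on $\mathcal M(\mathcal A)$ let $$\mathcal R(\mathcal Q)=\mathbb E_{P\sim\mathcal Q}\,\mathbb E_{(T_{n+1},D_{n+1})}\Big[\frac1m\sum_{j=1}^mR_{n+1}(A(D_{n+1}^{:j-1},P))\Big]$$ be the marginal transfer reward, where the inner expectation is unconditional, and let $$\widehat{\mathcal R}_\tau(\mathcal Q)=\mathbb E_{P\sim\mathcal Q}\Big[\frac1n\sum_{i=1}^n\frac1m\sum_{j=1}^m\widehat R_i^\tau(A(D_i^{:j-1},P),D_i)\Big]$$ be the clipped empirical multi-task reward. Assume condition (1): for every prior $P\in\mathcal M(\mathcal A)$, all $1\le j\le m$, all tasks $i\ge1$ and all $k\ge0$, $$\mathbb E_{(T_{i+k},D_{i+k})}\big[R_{i+k}(A(D_{i+k}^{:j},P))\big]\ \ge\ \mathbb E_{(T_i,D_i)}\big[R_i(A(D_i^{:j},P))\big].$$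 Then for every probability distribution $\mathcal P$ on $\mathcal M(\mathcal A)$ (the hyperprior, fixed before any data are observed), all $\lambda_1,\lambda_2,\tau>0$ and all $\delta\in(0,1]$, with probability at least $1-\delta$ over $(T_1,D_1),\dots,(T_n,D_n)$, simultaneously for all probability distributions $\mathcal Q$ on $\mathcal M(\mathcal A)$ (the hyperposteriors), $$\begin{aligned}\mathcal R(\mathcal Q)\ \ge\ &\widehat{\mathcal R}_\tau(\mathcal Q)-\Big(\frac1{\lambda_1}+\frac1{n\lambda_2}\Big)D_{\mathrm{KL}}(\mathcal Q\,\|\,\mathcal P)-\frac1{nm\lambda_2}\,\mathbb E_{P\sim\mathcal Q}\Big[\sum_{i=1}^n\sum_{j=1}^mD_{\mathrm{KL}}\big(A(D_i^{:j-1},P)\,\|\,P\big)\Big]\\&-c_n-\frac{\lambda_1}{8n}-\frac{\lambda_2(1+\tau)^2}{8m}-\frac1{\lambda_1}\ln\frac2\delta-\frac1{n\lambda_2}\ln\frac{2m}\delta,\end{aligned}$$ where the right-hand side is $-\infty$ if one of the divergence terms is infinite, and $$c_n=\sup_{P\in\mathcal M(\mathcal A)}\Big\{\frac1n\sum_{i=1}^n\mathbb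 E_{(T_i,D_i)}\Big[\frac1m\sum_{j=1}^mR_i(A(D_i^{:j-1},P))\,\Big|\,D_1,\dots,D_{i-1}\Big]-\frac1n\sum_{i=1}^n\mathbb E_{(T_i,D_i)}\Big[\frac1m\sum_{j=1}^mR_i(A(D_i^{:j-1},P))\Big]\Big\},$$ the conditional expectation given $D_1,\dots,D_{i-1}$ being the one computed by drawing $T_i\sim\mathcal T$ afresh and then $D_i$ with the behaviour policies. -/

import Mathlib

open MeasureTheory ProbabilityTheory
open scoped ENNReal

namespace LifelongBandit

/-! ### Tasks, policies, data sets -/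

/-- The set of all probability distributions over the finite action set, given by their mass
functions. Behaviour policies, priors and posteriors are elements of it. -/
abbrev Policy (𝒜 : Type*) [Fintype 𝒜] : Type _ := ↥(stdSimplex ℝ 𝒜)

/-- A bandit task: a reward distribution on `[0, 1]` for every action. -/
abbrev BanditTask (𝒜 : Type*) : Type _ := 𝒜 → ProbabilityMeasure unitInterval

/-- One observation: the chosen action and the reward obtained. -/
abbrev Round (𝒜 : Type*) : Type _ := 𝒜 × unitInterval

/-- A data set of `j` action-reward pairs. -/
abbrev Dataset (𝒜 : Type*) (j : ℕ) : Type _ := Fin j → Round 𝒜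

/-- The first `j` action-reward pairs of a data set. -/
def Dataset.take {𝒜 : Type*} {m : ℕ} (D : Dataset 𝒜 m) (j : ℕ) (hj : j ≤ m) : Dataset 𝒜 j :=
  fun k => D (Fin.castLE hj k)

/-- The behaviour policies chosen by the lifelong learner. `toFun i j H d` is the policy used in
task `i` to draw the action number `j` (both counted from `0`), after observing the data sets `H` of
the tasks before and the first `j` action-reward pairs `d` of the current task. -/
structure BehaviourPolicies (𝒜 : Type*) [Fintype 𝒜] [MeasurableSpace 𝒜] (m : ℕ) where
  toFun : (i j : ℕ) → (Fin i → Dataset 𝒜 m) → Dataset 𝒜 j → Policy 𝒜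
  measurable' : ∀ i j, Measurable fun x : (Fin i → Dataset 𝒜 m) × Dataset 𝒜 j =>
    toFun i j x.1 x.2

/-- A deterministic base learning algorithm: it maps a data set of any size and a prior to a
posterior. -/
structure LearningAlgorithm (𝒜 : Type*) [Fintype 𝒜] [MeasurableSpace 𝒜] where
  toFun : (j : ℕ) → Dataset 𝒜 j → Policy 𝒜 → Policy 𝒜
  measurable' : ∀ j, Measurable fun x : Dataset 𝒜 j × Policy 𝒜 => toFun j x.1 x.2

theorem measurable_snoc {X : Type*} [MeasurableSpace X] (n : ℕ) :
    Measurable fun x : (Fin n → X) × X => (Fin.snoc x.1 x.2 : Fin (n + 1) → X) := by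
  refine measurable_pi_lambda _ fun k => ?_
  refine Fin.lastCases ?_ (fun l => ?_) k
  · simpa using measurable_snd
  · simpa using (by fun_prop : Measurable fun x : (Fin n → X) × X => x.1 l)

section

variable {𝒜 : Type*} [Fintype 𝒜] [MeasurableSpace 𝒜] [DiscreteMeasurableSpace 𝒜]

/-- The probability measure with the given mass function. -/
noncomputable def Policy.toMeasure (p : Policy 𝒜) : Measure 𝒜 :=
  ∑ a, ENNReal.ofReal (p.1 a) • Measure.dirac a

instance (p : Policy 𝒜) : IsProbabilityMeasure p.toMeasure := ⟨by
  have h : ∑ a, ENNReal.ofReal (p.1 a) = 1 := by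
    rw [← ENNReal.ofReal_sum_of_nonneg fun a _ => p.2.1 a, p.2.2, ENNReal.ofReal_one]
  simpa [Policy.toMeasure] using h⟩

/-- Drawing an action from a policy. -/
noncomputable def actionKernel : Kernel (Policy 𝒜) 𝒜 where
  toFun p := p.toMeasure
  measurable' := by
    refine Measure.measurable_of_measurable_coe _ fun s _ => ?_
    simp only [Policy.toMeasure, Measure.coe_finsetSum, Measure.coe_smul, Finset.sum_apply,
      Pi.smul_apply, smul_eq_mul]
    exact Finset.measurable_sum _ fun a _ => (ENNReal.measurable_ofReal.comp
      ((measurable_pi_apply a).comp measurable_subtype_coe)).mul_const _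

instance : IsMarkovKernel (actionKernel (𝒜 := 𝒜)) :=
  ⟨fun p => inferInstanceAs (IsProbabilityMeasure p.toMeasure)⟩

/-- Drawing the reward of an action in a task. -/
noncomputable def rewardKernel : Kernel (BanditTask 𝒜 × 𝒜) unitInterval where
  toFun x := (x.1 x.2 : Measure unitInterval)
  measurable' := measurable_from_prod_countable_left fun a =>
    measurable_subtype_coe.comp (measurable_pi_apply a)

instance : IsMarkovKernel (rewardKernel (𝒜 := 𝒜)) :=
  ⟨fun x => inferInstanceAs (IsProbabilityMeasure (x.1 x.2 : Measure unitInterval))⟩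

/-! ### The law of the tasks and their data sets -/

variable {m : ℕ}

/-- One round in task number `i`: given the task, the earlier data sets and the rounds so far, draw
the action from the behaviour policy and then the reward from the task. -/
noncomputable def roundKernel (b : BehaviourPolicies 𝒜 m) (i j : ℕ) :
    Kernel ((BanditTask 𝒜 × (Fin i → Dataset 𝒜 m)) × Dataset 𝒜 j) (Round 𝒜) :=
  (actionKernel.comap (fun x => b.toFun i j x.1.2 x.2)
      ((b.measurable' i j).comp
        ((measurable_snd.comp measurable_fst).prodMk measurable_snd))) ⊗ₖ
    (rewardKernel.comap (fun y => (y.1.1.1, y.2)) (by fun_prop))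

instance (b : BehaviourPolicies 𝒜 m) (i j : ℕ) : IsMarkovKernel (roundKernel b i j) := by
  unfold roundKernel; infer_instance

/-- The law of the first `j` rounds in task number `i`, given the task and the earlier data sets. -/
noncomputable def roundsKernel (b : BehaviourPolicies 𝒜 m) (i : ℕ) :
    (j : ℕ) → Kernel (BanditTask 𝒜 × (Fin i → Dataset 𝒜 m)) (Dataset 𝒜 j)
  | 0 => Kernel.const _ (Measure.dirac Fin.elim0)
  | j + 1 => (roundsKernel b i j ⊗ₖ roundKernel b i j).map
      fun x => (Fin.snoc x.1 x.2 : Dataset 𝒜 (j + 1))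

instance (b : BehaviourPolicies 𝒜 m) (i j : ℕ) : IsMarkovKernel (roundsKernel b i j) := by
  induction j with
  | zero => unfold roundsKernel; infer_instance
  | succ j ih => unfold roundsKernel; exact Kernel.IsMarkovKernel.map _ (measurable_snoc j)

/-- The conditional law of the task number `i` and its data set, given the data sets of the tasks
before: the task is drawn from the environment, independently of the past, and the data set is then
collected with the behaviour policies. -/
noncomputable def taskKernel (env : ProbabilityMeasure (BanditTask 𝒜)) (b : BehaviourPolicies 𝒜 m)
    (i : ℕ) : Kernel (Fin i → Dataset 𝒜 m) (BanditTask 𝒜 × Dataset 𝒜 m) :=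
  Kernel.const _ (env : Measure (BanditTask 𝒜)) ⊗ₖ
    (roundsKernel b i m).comap Prod.swap measurable_swap

instance (env : ProbabilityMeasure (BanditTask 𝒜)) (b : BehaviourPolicies 𝒜 m) (i : ℕ) :
    IsMarkovKernel (taskKernel env b i) := by
  unfold taskKernel; infer_instance

/-- The joint law of the first `n` tasks and their data sets. -/
noncomputable def jointLaw (env : ProbabilityMeasure (BanditTask 𝒜)) (b : BehaviourPolicies 𝒜 m) :
    (n : ℕ) → Measure (Fin n → BanditTask 𝒜 × Dataset 𝒜 m)
  | 0 => Measure.dirac Fin.elim0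
  | n + 1 => (jointLaw env b n ⊗ₘ
        (taskKernel env b n).comap (fun ω k => (ω k).2) (by fun_prop)).map
      fun x => (Fin.snoc x.1 x.2 : Fin (n + 1) → BanditTask 𝒜 × Dataset 𝒜 m)

instance (env : ProbabilityMeasure (BanditTask 𝒜)) (b : BehaviourPolicies 𝒜 m) (n : ℕ) :
    IsProbabilityMeasure (jointLaw env b n) := by
  induction n with
  | zero => unfold jointLaw; infer_instance
  | succ n ih =>
    unfold jointLaw
    exact Measure.isProbabilityMeasure_map (measurable_snoc n).aemeasurable

/-- The (unconditional) expectation of `f (T, D)`, where `T` is the task number `i` (counted from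
`0`) and `D` is its data set. -/
noncomputable def taskExp (env : ProbabilityMeasure (BanditTask 𝒜)) (b : BehaviourPolicies 𝒜 m) (i : ℕ)
    (f : BanditTask 𝒜 × Dataset 𝒜 m → ℝ) : ℝ :=
  ∫ ω, f (ω (Fin.last i)) ∂(jointLaw env b (i + 1))

/-- The data sets of the tasks before task number `i`. -/
def past {n : ℕ} (ω : Fin n → BanditTask 𝒜 × Dataset 𝒜 m) (i : Fin n) : Fin i → Dataset 𝒜 m :=
  fun k => (ω (Fin.castLE i.isLt.le k)).2

/-- The conditional expectation of `f (T, D)` given the data sets of the tasks before, where `T` is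
the task number `i` and `D` is its data set. -/
noncomputable def taskCondExp (env : ProbabilityMeasure (BanditTask 𝒜)) (b : BehaviourPolicies 𝒜 m)
    {n : ℕ} (ω : Fin n → BanditTask 𝒜 × Dataset 𝒜 m) (i : Fin n) (f : BanditTask 𝒜 × Dataset 𝒜 m → ℝ) : ℝ :=
  ∫ x, f x ∂(taskKernel env b i (past ω i))

/-! ### Rewards -/

/-- The expected reward of an action in a task. -/
noncomputable def actionReward (T : BanditTask 𝒜) (a : 𝒜) : ℝ :=
  ∫ r, (r : ℝ) ∂(T a : Measure unitInterval)

/-- The expected reward of a policy in a task. -/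
noncomputable def policyReward (T : BanditTask 𝒜) (q : Policy 𝒜) : ℝ :=
  ∑ a, q.1 a * actionReward T a

/-- The posterior computed from the first `j` rounds of a data set and the prior `P`. -/
def LearningAlgorithm.posterior (A : LearningAlgorithm 𝒜) (D : Dataset 𝒜 m) (j : ℕ) (hj : j ≤ m)
    (P : Policy 𝒜) : Policy 𝒜 :=
  A.toFun j (D.take j hj) P

/-- The average, over the `m` rounds of a task, of the expected reward of the posterior that is
computed from the rounds before. -/
noncomputable def averageReward (A : LearningAlgorithm 𝒜) (P : Policy 𝒜)
    (x : BanditTask 𝒜 × Dataset 𝒜 m) : ℝ :=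
  (1 / m) * ∑ j : Fin m, policyReward x.1 (A.posterior x.2 j j.isLt.le P)

/-- For every prior and every number `1 ≤ j ≤ m` of training samples, the marginal expected reward
of the posterior does not decrease from a task to a later one. -/
def MonotoneExpectedReward (env : ProbabilityMeasure (BanditTask 𝒜)) (b : BehaviourPolicies 𝒜 m)
    (A : LearningAlgorithm 𝒜) : Prop :=
  ∀ (P : Policy 𝒜) (j : ℕ) (hj : j ≤ m), 1 ≤ j → ∀ i k : ℕ,
    taskExp env b i (fun x => policyReward x.1 (A.posterior x.2 j hj P)) ≤
      taskExp env b (i + k) (fun x => policyReward x.1 (A.posterior x.2 j hj P))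

/-- The marginal transfer reward of `Q`: the expected average reward on the next task, number `n`
counted from `0`. -/
noncomputable def transferReward (env : ProbabilityMeasure (BanditTask 𝒜)) (b : BehaviourPolicies 𝒜 m)
    (A : LearningAlgorithm 𝒜) (n : ℕ) (Q : ProbabilityMeasure (Policy 𝒜)) : ℝ :=
  ∫ P, taskExp env b n (averageReward A P) ∂(Q : Measure (Policy 𝒜))

/-- The clipped importance-weighted reward estimate of the action `a` in task number `i`. Almost
surely no action of zero probability is drawn, so the weights are almost surely never `1 / 0`. -/
noncomputable def clippedEstimate [DecidableEq 𝒜] (b : BehaviourPolicies 𝒜 m) (τ : ℝ) {n : ℕ}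
    (ω : Fin n → BanditTask 𝒜 × Dataset 𝒜 m) (i : Fin n) (a : 𝒜) : ℝ :=
  (1 / m) * ∑ j : Fin m,
    min (1 / (b.toFun i j (past ω i) ((ω i).2.take j j.isLt.le)).1 ((ω i).2 j).1) (1 + τ) *
      (((ω i).2 j).2 : ℝ) * (if ((ω i).2 j).1 = a then 1 else 0)

/-- The clipped empirical multi-task reward of `Q`. -/
noncomputable def clippedReward [DecidableEq 𝒜] (b : BehaviourPolicies 𝒜 m)
    (A : LearningAlgorithm 𝒜) (τ : ℝ) {n : ℕ} (ω : Fin n → BanditTask 𝒜 × Dataset 𝒜 m)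
    (Q : ProbabilityMeasure (Policy 𝒜)) : ℝ :=
  ∫ P, (1 / n) * ∑ i : Fin n, (1 / m) * ∑ j : Fin m,
      ∑ a, (A.posterior (ω i).2 j j.isLt.le P).1 a * clippedEstimate b τ ω i a
    ∂(Q : Measure (Policy 𝒜))

/-- The term `c_n`: the supremum over the priors of the average, over the first `n` tasks, of the
conditional minus the unconditional expectation of the average reward. -/
noncomputable def dependenceTerm (env : ProbabilityMeasure (BanditTask 𝒜)) (b : BehaviourPolicies 𝒜 m)
    (A : LearningAlgorithm 𝒜) {n : ℕ} (ω : Fin n → BanditTask 𝒜 × Dataset 𝒜 m) : ℝ :=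
  ⨆ P : Policy 𝒜,
    ((1 / n) * ∑ i : Fin n, taskCondExp env b ω i (averageReward A P) -
      (1 / n) * ∑ i : Fin n, taskExp env b i (averageReward A P))

/-- The expectation over `P` drawn from `Q` of the sum, over all tasks and rounds, of the
Kullback-Leibler divergences of the posteriors from the prior `P`. -/
noncomputable def posteriorKL (A : LearningAlgorithm 𝒜) {n : ℕ}
    (ω : Fin n → BanditTask 𝒜 × Dataset 𝒜 m) (Q : ProbabilityMeasure (Policy 𝒜)) : ℝ≥0∞ :=
  ∫⁻ P, ∑ i : Fin n, ∑ j : Fin m, InformationTheory.klDiv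
      (A.posterior (ω i).2 j j.isLt.le P).toMeasure P.toMeasure
    ∂(Q : Measure (Policy 𝒜))

end

end LifelongBandit

open LifelongBandit

/-! The gap between the clipped empirical reward and the transfer reward splits into four: from the
clipped estimates to the true rewards of the observed tasks, from these to their conditional
expectations given the past data, from conditional to unconditional expectations, and from the
observed tasks to the next one. The third gap is at most `dependenceTerm` for every prior. The
fourth has the right sign by `MonotoneExpectedReward` or, for a posterior computed from no data,
because all tasks have the same law.

The first two gaps are random. Each is controlled by `exists_measurableSet_forall_integral_le`: an
exponential moment bounded for every fixed prior is averaged over the hyperprior, Markov's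
inequality bounds the average off an event of probability at most `δ / 2`, and the Donsker-Varadhan
inequality then treats all hyperposteriors at once. The moments come from Hoeffding's lemma applied
conditionally to one round or one task at a time; `lintegral_prod_roundsKernel_le` and
`lintegral_prod_jointLaw_le` multiply these bounds although the data are dependent.

The second gap is a sum of martingale differences over the tasks. The first needs another change of
measure, on actions, from the prior to each posterior (`ofReal_estimate_sub_log_le_klDiv`). What
enters the PAC-Bayes bound is `logEstimateMoment`, which involves the prior but no posterior. It
serves all rounds of a task together, so no union bound over rounds is needed. -/

/-! ### Change of measure and Hoeffding's lemma -/

/-- The easy half of the Donsker-Varadhan variational formula. -/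
theorem ofReal_integral_sub_log_integral_exp_le_klDiv {α : Type*} [MeasurableSpace α]
    (μ ν : Measure α) [IsProbabilityMeasure μ] [IsProbabilityMeasure ν] {f : α → ℝ}
    (hf : Measurable f) {C : ℝ} (hC : ∀ x, |f x| ≤ C) :
    ENNReal.ofReal (∫ x, f x ∂μ - Real.log (∫ x, Real.exp (f x) ∂ν)) ≤
      InformationTheory.klDiv μ ν := by
  by_cases htop : InformationTheory.klDiv μ ν = ∞
  · simp [htop]
  obtain ⟨hac, hint⟩ := InformationTheory.klDiv_ne_top_iff.1 htop
  have hfμ : Integrable f μ := Integrable.of_bound hf.aestronglyMeasurable C (ae_of_all _ hC)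
  have hfν : Integrable (fun x => Real.exp (f x)) ν :=
    Integrable.of_bound hf.exp.aestronglyMeasurable (Real.exp C) (ae_of_all _ fun x => by
      rw [Real.norm_eq_abs, Real.abs_exp]
      exact Real.exp_le_exp.2 ((le_abs_self _).trans (hC x)))
  have : IsProbabilityMeasure (ν.tilted f) := isProbabilityMeasure_tilted hfν
  -- The divergence of `μ` from `ν` equals its divergence from the tilted measure plus the left-hand
  -- side; the former is nonnegative by `h2`.
  have h1 := integral_llr_tilted_right hac hfμ hfν hint
  have h2 := InformationTheory.integral_llr_add_sub_measure_univ_nonneg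
    (hac.trans (absolutelyContinuous_tilted hfν)) (integrable_llr_tilted_right hac hfμ hint hfν)
  have h3 := InformationTheory.toReal_klDiv_of_measure_eq hac (by simp)
  simp only [probReal_univ] at h2
  rw [ENNReal.ofReal_le_iff_le_toReal htop, h3]
  linarith

/-- Hoeffding's lemma in a form that only needs an upper bound on the mean. -/
theorem lintegral_exp_mul_sub_le {α : Type*} [MeasurableSpace α] (μ : Measure α)
    [IsProbabilityMeasure μ] {f : α → ℝ} (hf : Measurable f) {c : ℝ} (h0 : ∀ x, 0 ≤ f x)
    (hc : ∀ x, f x ≤ c) {M : ℝ} (hM : ∫ x, f x ∂μ ≤ M) {s : ℝ} (hs : 0 ≤ s) :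
    ∫⁻ x, ENNReal.ofReal (Real.exp (s * (f x - M))) ∂μ ≤
      ENNReal.ofReal (Real.exp (s ^ 2 * c ^ 2 / 8)) := by
  have hsub := hasSubgaussianMGF_of_mem_Icc (μ := μ) hf.aemeasurable
    (ae_of_all _ fun x => (⟨h0 x, hc x⟩ : f x ∈ Set.Icc 0 c))
  rw [← ofReal_integral_eq_lintegral_ofReal _ (ae_of_all _ fun x => (Real.exp_pos _).le)]
  · refine ENNReal.ofReal_le_ofReal ?_
    calc ∫ x, Real.exp (s * (f x - M)) ∂μ
        ≤ ∫ x, Real.exp (s * (f x - ∫ x, f x ∂μ)) ∂μ := by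
          refine integral_mono_of_nonneg (ae_of_all _ fun x => (Real.exp_pos _).le)
            (hsub.integrable_exp_mul s) (ae_of_all _ fun x => ?_)
          -- Since `s ≥ 0`, replacing the mean by the larger `M` only lowers the exponential; this
          -- lets a downward biased estimate pass.
          exact Real.exp_le_exp.2 (by gcongr)
      _ ≤ _ := by
          refine (hsub.mgf_le s).trans (le_of_eq ?_)
          simp only [sub_zero, NNReal.coe_pow, NNReal.coe_div, coe_nnnorm, Real.norm_eq_abs,
            NNReal.coe_ofNat, div_pow, sq_abs]
          ring_nf
  · refine Integrable.of_bound (by fun_prop) (Real.exp (s * (c - M))) (ae_of_all _ fun x => ?_)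
    rw [Real.norm_eq_abs, Real.abs_exp]
    exact Real.exp_le_exp.2 (by gcongr; exact hc x)

/-! ### Exponential moments of adaptively collected data -/

namespace LifelongBandit

@[fun_prop]
theorem measurable_take {𝒜 : Type*} [MeasurableSpace 𝒜] {m : ℕ} (j : ℕ) (hj : j ≤ m) :
    Measurable fun D : Dataset 𝒜 m => D.take j hj := by
  unfold Dataset.take
  fun_prop

@[fun_prop]
theorem measurable_past {𝒜 : Type*} [MeasurableSpace 𝒜] {m n : ℕ} (i : Fin n) :
    Measurable fun ω : Fin n → BanditTask 𝒜 × Dataset 𝒜 m => past ω i := by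
  unfold past
  fun_prop

variable {𝒜 : Type*} [Fintype 𝒜] [MeasurableSpace 𝒜] [DiscreteMeasurableSpace 𝒜] {m : ℕ}

/-- The supermartingale argument: the last factor is integrated out first, conditionally on the
rounds before, and costs at most `c`. Lower integrals make integrability irrelevant. -/
theorem lintegral_prod_roundsKernel_le (b : BehaviourPolicies 𝒜 m) (i : ℕ)
    (z : BanditTask 𝒜 × (Fin i → Dataset 𝒜 m)) {h : (j : ℕ) → Dataset 𝒜 j → Round 𝒜 → ℝ≥0∞}
    (hh : ∀ j, Measurable fun x : Dataset 𝒜 j × Round 𝒜 => h j x.1 x.2) {c : ℝ≥0∞}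
    (hc : ∀ j < m, ∀ d, ∫⁻ y, h j d y ∂(roundKernel b i j (z, d)) ≤ c) (k : ℕ) (hk : k ≤ m) :
    ∫⁻ D, ∏ j : Fin k, h j (D.take j j.isLt.le) (D j) ∂(roundsKernel b i k z) ≤ c ^ k := by
  induction k with
  | zero => simp
  | succ k ih =>
    have hmeas (l : ℕ) :
        Measurable fun D : Dataset 𝒜 l => ∏ j : Fin l, h j (D.take j j.isLt.le) (D j) := by
      refine Finset.measurable_prod _ fun j _ => (hh j).comp (f := fun D : Dataset 𝒜 l =>
        (D.take j j.isLt.le, D j)) (by fun_prop)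
    have hsnoc (d : Dataset 𝒜 k) (y : Round 𝒜) :
        ∏ j : Fin (k + 1), h j (Dataset.take (Fin.snoc d y : Dataset 𝒜 (k + 1)) j j.isLt.le)
          ((Fin.snoc d y : Dataset 𝒜 (k + 1)) j) =
        (∏ j : Fin k, h j (d.take j j.isLt.le) (d j)) * h k d y := by
      rw [Fin.prod_univ_castSucc]
      congr 1
      · refine Finset.prod_congr rfl fun j _ => ?_
        congr 1
        · funext l
          exact Fin.snoc_castSucc (α := fun _ => Round 𝒜) y d (Fin.castLE j.isLt.le l)
        · simp
      · congr 1
        · funext l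
          exact Fin.snoc_castSucc (α := fun _ => Round 𝒜) y d l
        · simp
    rw [roundsKernel, Kernel.map_apply _ (measurable_snoc k),
      lintegral_map (hmeas _) (measurable_snoc k)]
    simp_rw [hsnoc]
    rw [Kernel.lintegral_compProd _ _ _ (by exact ((hmeas k).comp measurable_fst).mul (hh k))]
    calc _ ≤ ∫⁻ d, (∏ j : Fin k, h j (d.take j j.isLt.le) (d j)) * c ∂(roundsKernel b i k z) := by
          refine lintegral_mono fun d => ?_
          dsimp only
          rw [lintegral_const_mul _ (by exact (hh k).comp measurable_prodMk_left)]
          gcongr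
          exact hc k hk d
      _ ≤ c ^ (k + 1) := by
          rw [lintegral_mul_const _ (hmeas _), pow_succ]
          gcongr
          exact ih (Nat.le_of_succ_le hk)

/-- The same induction over tasks. Given the earlier tasks and data, the law of the next pair
depends on the data alone, so a bound for `taskKernel` suffices. -/
theorem lintegral_prod_jointLaw_le (env : ProbabilityMeasure (BanditTask 𝒜))
    (b : BehaviourPolicies 𝒜 m)
    {g : (i : ℕ) → (Fin i → Dataset 𝒜 m) → BanditTask 𝒜 × Dataset 𝒜 m → ℝ≥0∞}
    (hg : ∀ i, Measurable fun x : (Fin i → Dataset 𝒜 m) × (BanditTask 𝒜 × Dataset 𝒜 m) =>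
      g i x.1 x.2) {c : ℝ≥0∞} (hc : ∀ i H, ∫⁻ x, g i H x ∂(taskKernel env b i H) ≤ c) (n : ℕ) :
    ∫⁻ ω, ∏ i : Fin n, g i (past ω i) (ω i) ∂(jointLaw env b n) ≤ c ^ n := by
  induction n with
  | zero => simp
  | succ n ih =>
    have hmeas (l : ℕ) : Measurable fun ω : Fin l → BanditTask 𝒜 × Dataset 𝒜 m =>
        ∏ i : Fin l, g i (past ω i) (ω i) := by
      refine Finset.measurable_prod _ fun i _ => (hg i).comp
        (f := fun ω : Fin l → BanditTask 𝒜 × Dataset 𝒜 m => (past ω i, ω i)) (by fun_prop)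
    have hsnoc (ω : Fin n → BanditTask 𝒜 × Dataset 𝒜 m) (y : BanditTask 𝒜 × Dataset 𝒜 m) :
        ∏ i : Fin (n + 1), g i
          (past (Fin.snoc ω y : Fin (n + 1) → BanditTask 𝒜 × Dataset 𝒜 m) i)
          ((Fin.snoc ω y : Fin (n + 1) → BanditTask 𝒜 × Dataset 𝒜 m) i) =
        (∏ i : Fin n, g i (past ω i) (ω i)) * g n (fun k => (ω k).2) y := by
      rw [Fin.prod_univ_castSucc]
      congr 1
      · refine Finset.prod_congr rfl fun i _ => ?_
        congr 1
        · funext l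
          exact congrArg Prod.snd (Fin.snoc_castSucc
            (α := fun _ => BanditTask 𝒜 × Dataset 𝒜 m) y ω (Fin.castLE i.isLt.le l))
        · simp
      · congr 1
        · funext l
          exact congrArg Prod.snd (Fin.snoc_castSucc
            (α := fun _ => BanditTask 𝒜 × Dataset 𝒜 m) y ω l)
        · simp
    rw [jointLaw, lintegral_map (hmeas _) (measurable_snoc n)]
    simp_rw [hsnoc]
    rw [Measure.lintegral_compProd (by
      exact ((hmeas n).comp measurable_fst).mul
        ((hg n).comp (f := fun x : (Fin n → BanditTask 𝒜 × Dataset 𝒜 m) ×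
          (BanditTask 𝒜 × Dataset 𝒜 m) => (fun k => (x.1 k).2, x.2)) (by fun_prop)))]
    calc _ ≤ ∫⁻ ω, (∏ i : Fin n, g i (past ω i) (ω i)) * c ∂(jointLaw env b n) := by
          refine lintegral_mono fun ω => ?_
          dsimp only
          rw [lintegral_const_mul _ (by exact (hg n).comp measurable_prodMk_left)]
          gcongr
          exact hc n _
      _ ≤ c ^ (n + 1) := by
          rw [lintegral_mul_const _ (hmeas _), pow_succ]
          gcongr

end LifelongBandit

/-! ### Ranges and measurability of rewards and estimates -/

namespace LifelongBandit

variable {𝒜 : Type*} {m : ℕ}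

theorem actionReward_nonneg (T : BanditTask 𝒜) (a : 𝒜) : 0 ≤ actionReward T a :=
  integral_nonneg fun r => r.2.1

theorem actionReward_le_one (T : BanditTask 𝒜) (a : 𝒜) : actionReward T a ≤ 1 := by
  have h : ∫ r, (r : ℝ) ∂(T a : Measure unitInterval) ≤
      ∫ _, (1 : ℝ) ∂(T a : Measure unitInterval) :=
    integral_mono_of_nonneg (ae_of_all _ fun r => r.2.1) (integrable_const _)
      (ae_of_all _ fun r => r.2.2)
  simpa [actionReward] using h

theorem average_mem_Icc (hm : 0 < m) {f : Fin m → ℝ} {c d : ℝ} (hf : ∀ j, f j ∈ Set.Icc c d) :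
    (1 / (m : ℝ)) * ∑ j, f j ∈ Set.Icc c d := by
  have hm' : (0 : ℝ) < m := Nat.cast_pos.2 hm
  have h1 : m * c ≤ ∑ j, f j := by
    simpa using Finset.sum_le_sum (s := Finset.univ) fun j _ => (hf j).1
  have h2 : ∑ j, f j ≤ m * d := by
    simpa using Finset.sum_le_sum (s := Finset.univ) fun j _ => (hf j).2
  rw [one_div, inv_mul_eq_div]
  exact ⟨(le_div_iff₀' hm').2 h1, (div_le_iff₀' hm').2 h2⟩

variable [Fintype 𝒜]

theorem Policy.sum_mul_mem_Icc (q : Policy 𝒜) {f : 𝒜 → ℝ} {c d : ℝ}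
    (hf : ∀ a, f a ∈ Set.Icc c d) : ∑ a, q.1 a * f a ∈ Set.Icc c d := by
  constructor
  · calc c = ∑ a, q.1 a * c := by rw [← Finset.sum_mul, q.2.2, one_mul]
      _ ≤ _ := Finset.sum_le_sum fun a _ => mul_le_mul_of_nonneg_left (hf a).1 (q.2.1 a)
  · calc _ ≤ ∑ a, q.1 a * d :=
          Finset.sum_le_sum fun a _ => mul_le_mul_of_nonneg_left (hf a).2 (q.2.1 a)
      _ = d := by rw [← Finset.sum_mul, q.2.2, one_mul]

theorem policyReward_mem_Icc (T : BanditTask 𝒜) (q : Policy 𝒜) :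
    policyReward T q ∈ Set.Icc 0 1 :=
  q.sum_mul_mem_Icc fun a => ⟨actionReward_nonneg T a, actionReward_le_one T a⟩

variable [MeasurableSpace 𝒜]

theorem measurable_posterior (A : LearningAlgorithm 𝒜) (j : ℕ) (hj : j ≤ m) :
    Measurable fun x : Dataset 𝒜 m × Policy 𝒜 => A.posterior x.1 j hj x.2 :=
  (A.measurable' j).comp (f := fun x : Dataset 𝒜 m × Policy 𝒜 => (x.1.take j hj, x.2))
    (by fun_prop)

theorem averageReward_mem_Icc (hm : 0 < m) (A : LearningAlgorithm 𝒜) (P : Policy 𝒜)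
    (x : BanditTask 𝒜 × Dataset 𝒜 m) : averageReward A P x ∈ Set.Icc 0 1 :=
  average_mem_Icc hm fun _ => policyReward_mem_Icc _ _

/-- The clipped importance-weighted reward that a single round contributes to the estimate for the
action `a`. -/
noncomputable def weightedReward [DecidableEq 𝒜] (b : BehaviourPolicies 𝒜 m) (τ : ℝ) (i j : ℕ)
    (H : Fin i → Dataset 𝒜 m) (d : Dataset 𝒜 j) (a : 𝒜) (y : Round 𝒜) : ℝ :=
  min (1 / (b.toFun i j H d).1 y.1) (1 + τ) * (y.2 : ℝ) * (if y.1 = a then 1 else 0)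

theorem weightedReward_mem_Icc [DecidableEq 𝒜] (b : BehaviourPolicies 𝒜 m) {τ : ℝ} (hτ : 0 < τ)
    (i j : ℕ)
    (H : Fin i → Dataset 𝒜 m) (d : Dataset 𝒜 j) (a : 𝒜) (y : Round 𝒜) :
    weightedReward b τ i j H d a y ∈ Set.Icc 0 (1 + τ) := by
  have h0 : 0 ≤ (b.toFun i j H d).1 y.1 := (b.toFun i j H d).2.1 _
  have h1 : 0 ≤ min (1 / (b.toFun i j H d).1 y.1) (1 + τ) := le_min (by positivity) (by positivity)
  have h2 : min (1 / (b.toFun i j H d).1 y.1) (1 + τ) ≤ 1 + τ := min_le_right _ _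
  have h3 : (0 : ℝ) ≤ y.2 := y.2.2.1
  have h4 : (y.2 : ℝ) ≤ 1 := y.2.2.2
  unfold weightedReward
  split_ifs
  · rw [mul_one]
    exact ⟨mul_nonneg h1 h3, by nlinarith⟩
  · rw [mul_zero]
    exact ⟨le_rfl, by positivity⟩

/-- The clipped reward estimate of an action in task number `i`, as a function of the earlier data
sets `H` and the data set `D` of the task. -/
noncomputable def taskEstimate [DecidableEq 𝒜] (b : BehaviourPolicies 𝒜 m) (τ : ℝ) (i : ℕ)
    (H : Fin i → Dataset 𝒜 m) (D : Dataset 𝒜 m) (a : 𝒜) : ℝ :=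
  (1 / m) * ∑ j : Fin m, weightedReward b τ i j H (D.take j j.isLt.le) a (D j)

theorem taskEstimate_mem_Icc [DecidableEq 𝒜] (hm : 0 < m) (b : BehaviourPolicies 𝒜 m) {τ : ℝ}
    (hτ : 0 < τ) (i : ℕ)
    (H : Fin i → Dataset 𝒜 m) (D : Dataset 𝒜 m) (a : 𝒜) :
    taskEstimate b τ i H D a ∈ Set.Icc 0 (1 + τ) :=
  average_mem_Icc hm fun _ => weightedReward_mem_Icc b hτ _ _ _ _ _ _

/-- The exponential moment, for an action drawn from the prior `P`, of the error of the clipped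
reward estimate in task number `i`. -/
noncomputable def estimateMoment [DecidableEq 𝒜] (b : BehaviourPolicies 𝒜 m) (τ s : ℝ)
    (P : Policy 𝒜) (i : ℕ)
    (H : Fin i → Dataset 𝒜 m) (x : BanditTask 𝒜 × Dataset 𝒜 m) : ℝ :=
  ∑ a, P.1 a * Real.exp (s * (taskEstimate b τ i H x.2 a - actionReward x.1 a))

theorem estimateMoment_mem_Icc [DecidableEq 𝒜] (hm : 0 < m) (b : BehaviourPolicies 𝒜 m) {τ s : ℝ}
    (hτ : 0 < τ)
    (hs : 0 ≤ s) (P : Policy 𝒜) (i : ℕ) (H : Fin i → Dataset 𝒜 m)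
    (x : BanditTask 𝒜 × Dataset 𝒜 m) :
    estimateMoment b τ s P i H x ∈ Set.Icc (Real.exp (-s)) (Real.exp (s * (1 + τ))) := by
  refine P.sum_mul_mem_Icc fun a => ?_
  have h1 := taskEstimate_mem_Icc hm b hτ i H x.2 a
  have h2 := actionReward_nonneg x.1 a
  have h3 := actionReward_le_one x.1 a
  refine ⟨Real.exp_le_exp.2 ?_, Real.exp_le_exp.2 ?_⟩
  · nlinarith [h1.1]
  · exact mul_le_mul_of_nonneg_left (by linarith [h1.2]) hs

variable [DiscreteMeasurableSpace 𝒜]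

theorem measurable_policy_apply : Measurable fun x : Policy 𝒜 × 𝒜 => x.1.1 x.2 :=
  measurable_from_prod_countable_left fun a =>
    (measurable_pi_apply a).comp measurable_subtype_coe

theorem measurable_actionReward (a : 𝒜) :
    Measurable fun T : BanditTask 𝒜 => actionReward T a :=
  (StronglyMeasurable.integral_kernel (κ := (rewardKernel (𝒜 := 𝒜)).comap (fun T => (T, a))
    (by fun_prop)) (f := fun r : unitInterval => (r : ℝ))
    measurable_subtype_coe.stronglyMeasurable).measurable

theorem measurable_policyReward :
    Measurable fun x : BanditTask 𝒜 × Policy 𝒜 => policyReward x.1 x.2 := by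
  refine Finset.measurable_sum _ fun a _ => ?_
  exact ((measurable_pi_apply a).comp (measurable_subtype_coe.comp measurable_snd)).mul
    ((measurable_actionReward a).comp measurable_fst)

theorem measurable_policyReward_posterior (A : LearningAlgorithm 𝒜) (j : ℕ) (hj : j ≤ m) :
    Measurable fun x : Policy 𝒜 × (BanditTask 𝒜 × Dataset 𝒜 m) =>
      policyReward x.2.1 (A.posterior x.2.2 j hj x.1) :=
  measurable_policyReward.comp ((measurable_fst.comp measurable_snd).prodMk
    ((measurable_posterior A j hj).comp
      ((measurable_snd.comp measurable_snd).prodMk measurable_fst)))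

theorem measurable_averageReward (A : LearningAlgorithm 𝒜) :
    Measurable fun x : Policy 𝒜 × (BanditTask 𝒜 × Dataset 𝒜 m) => averageReward A x.1 x.2 :=
  (Finset.measurable_sum _ fun (j : Fin m) _ =>
    measurable_policyReward_posterior A j j.isLt.le).const_mul _

theorem integral_toMeasure (p : Policy 𝒜) (f : 𝒜 → ℝ) :
    ∫ a, f a ∂p.toMeasure = ∑ a, p.1 a * f a := by
  rw [Policy.toMeasure, integral_finsetSum_measure]
  · refine Finset.sum_congr rfl fun a _ => ?_
    rw [integral_smul_measure, integral_dirac, ENNReal.toReal_ofReal (p.2.1 a), smul_eq_mul]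
  · intro a _
    exact (Integrable.of_finite).smul_measure ENNReal.ofReal_ne_top

/-! ### The clipped estimate within one task -/

variable [DecidableEq 𝒜]

theorem measurable_weightedReward (b : BehaviourPolicies 𝒜 m) (τ : ℝ) (i j : ℕ) (a : 𝒜) :
    Measurable fun x : (Fin i → Dataset 𝒜 m) × (Dataset 𝒜 j × Round 𝒜) =>
      weightedReward b τ i j x.1 x.2.1 a x.2.2 := by
  have h1 : Measurable fun x : (Fin i → Dataset 𝒜 m) × (Dataset 𝒜 j × Round 𝒜) =>
      (b.toFun i j x.1 x.2.1).1 x.2.2.1 :=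
    measurable_policy_apply.comp (((b.measurable' i j).comp
      (measurable_fst.prodMk (measurable_fst.comp measurable_snd))).prodMk
        (measurable_fst.comp (measurable_snd.comp measurable_snd)))
  have h2 : Measurable fun x : (Fin i → Dataset 𝒜 m) × (Dataset 𝒜 j × Round 𝒜) =>
      (if x.2.2.1 = a then 1 else 0 : ℝ) :=
    (Measurable.of_discrete (f := fun a' : 𝒜 => (if a' = a then 1 else 0 : ℝ))).comp
      (measurable_fst.comp (measurable_snd.comp measurable_snd))
  exact (((measurable_const.div h1).min measurable_const).mul
    (measurable_subtype_coe.comp (measurable_snd.comp (measurable_snd.comp measurable_snd)))).mul h2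

/-- Unclipped importance weights are unbiased for actions of positive probability, and clipping only
lowers them. An upper bound on the mean is all that a lower bound on the transfer reward requires.
-/
theorem integral_weightedReward_le (b : BehaviourPolicies 𝒜 m) {τ : ℝ} (hτ : 0 < τ) (i j : ℕ)
    (T : BanditTask 𝒜) (H : Fin i → Dataset 𝒜 m) (d : Dataset 𝒜 j) (a : 𝒜) :
    ∫ y, weightedReward b τ i j H d a y ∂(roundKernel b i j ((T, H), d)) ≤ actionReward T a := by
  have hmeas : Measurable fun y => weightedReward b τ i j H d a y :=
    (measurable_weightedReward b τ i j a).comp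
      (f := fun y : Round 𝒜 => (H, (d, y))) (by fun_prop)
  have hint : Integrable (fun y => weightedReward b τ i j H d a y)
      (roundKernel b i j ((T, H), d)) :=
    Integrable.of_mem_Icc 0 (1 + τ) hmeas.aemeasurable
      (ae_of_all _ fun y => weightedReward_mem_Icc b hτ i j H d a y)
  unfold roundKernel at hint ⊢
  rw [integral_compProd hint]
  have hinner (a' : 𝒜) : ∫ r, weightedReward b τ i j H d a (a', r)
      ∂(((rewardKernel (𝒜 := 𝒜)).comap (fun y : ((BanditTask 𝒜 × (Fin i → Dataset 𝒜 m)) ×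
        Dataset 𝒜 j) × 𝒜 => (y.1.1.1, y.2)) (by fun_prop)) (((T, H), d), a')) =
      min (1 / (b.toFun i j H d).1 a') (1 + τ) * (if a' = a then 1 else 0) * actionReward T a' := by
    unfold weightedReward actionReward
    change ∫ r : unitInterval, min (1 / (b.toFun i j H d).1 a') (1 + τ) * (r : ℝ) *
      (if a' = a then 1 else 0) ∂(T a' : Measure unitInterval) = _
    rw [integral_mul_const, integral_const_mul]
    ring
  simp_rw [hinner]
  change ∫ a', _ ∂((b.toFun i j H d).toMeasure) ≤ _
  rw [integral_toMeasure, Finset.sum_eq_single a (fun a' _ h => by simp [h]) (by simp)]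
  have h0 : 0 ≤ (b.toFun i j H d).1 a := (b.toFun i j H d).2.1 _
  -- An inequality rather than an equality also before clipping: if the action has probability zero,
  -- the quotient is `0 / 0 = 0`.
  have h1 : (b.toFun i j H d).1 a * min (1 / (b.toFun i j H d).1 a) (1 + τ) ≤ 1 := by
    refine (mul_le_mul_of_nonneg_left (min_le_left _ _) h0).trans ?_
    rw [mul_one_div]
    exact div_self_le_one _
  have h2 := actionReward_nonneg T a
  simp only [if_true, mul_one]
  nlinarith

theorem measurable_taskEstimate (b : BehaviourPolicies 𝒜 m) (τ : ℝ) (i : ℕ) (a : 𝒜) :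
    Measurable fun x : (Fin i → Dataset 𝒜 m) × Dataset 𝒜 m => taskEstimate b τ i x.1 x.2 a := by
  refine (Finset.measurable_sum _ fun j _ => ?_).const_mul _
  exact (measurable_weightedReward b τ i j a).comp
    (f := fun x : (Fin i → Dataset 𝒜 m) × Dataset 𝒜 m => (x.1, (x.2.take j j.isLt.le, x.2 j)))
    (by fun_prop)

/-- Each of the `m` rounds carries the parameter `s / m`, so Hoeffding's exponents add up to `m * (s
/ m) ^ 2 * (1 + τ) ^ 2 / 8`; this is the source of the factor `1 / m`. -/
theorem lintegral_exp_taskEstimate_le (hm : 0 < m) (b : BehaviourPolicies 𝒜 m) {τ : ℝ} (hτ : 0 < τ)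
    (i : ℕ) (T : BanditTask 𝒜) (H : Fin i → Dataset 𝒜 m) (a : 𝒜) {s : ℝ} (hs : 0 ≤ s) :
    ∫⁻ D, ENNReal.ofReal (Real.exp (s * (taskEstimate b τ i H D a - actionReward T a)))
      ∂(roundsKernel b i m (T, H)) ≤
      ENNReal.ofReal (Real.exp (s ^ 2 * (1 + τ) ^ 2 / (8 * m))) := by
  have hm' : (0 : ℝ) < m := Nat.cast_pos.2 hm
  have hw (j : ℕ) : Measurable fun x : Dataset 𝒜 j × Round 𝒜 =>
      weightedReward b τ i j H x.1 a x.2 :=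
    (measurable_weightedReward b τ i j a).comp
      (f := fun x : Dataset 𝒜 j × Round 𝒜 => (H, x)) (by fun_prop)
  have key := lintegral_prod_roundsKernel_le b i (T, H)
    (h := fun j d y => ENNReal.ofReal
      (Real.exp (s / m * (weightedReward b τ i j H d a y - actionReward T a))))
    (fun j => ENNReal.measurable_ofReal.comp
      (((hw j).sub_const _).const_mul _).exp)
    (c := ENNReal.ofReal (Real.exp ((s / m) ^ 2 * (1 + τ) ^ 2 / 8)))
    (fun j _ d => lintegral_exp_mul_sub_le _ ((hw j).comp measurable_prodMk_left)
      (fun y => (weightedReward_mem_Icc b hτ i j H d a y).1)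
      (fun y => (weightedReward_mem_Icc b hτ i j H d a y).2)
      (integral_weightedReward_le b hτ i j T H d a) (by positivity)) m le_rfl
  refine (le_of_eq ?_).trans (key.trans (le_of_eq ?_))
  · refine lintegral_congr fun D => ?_
    rw [← ENNReal.ofReal_prod_of_nonneg fun _ _ => (Real.exp_pos _).le, ← Real.exp_sum]
    congr 2
    rw [← Finset.mul_sum, Finset.sum_sub_distrib, taskEstimate]
    simp only [Finset.sum_const, Finset.card_univ, Fintype.card_fin, nsmul_eq_mul]
    field_simp
  · rw [← ENNReal.ofReal_pow (Real.exp_pos _).le, ← Real.exp_nat_mul]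
    congr 2
    field_simp

theorem measurable_estimateMoment (b : BehaviourPolicies 𝒜 m) (τ s : ℝ) (i : ℕ) :
    Measurable fun x : Policy 𝒜 × ((Fin i → Dataset 𝒜 m) × (BanditTask 𝒜 × Dataset 𝒜 m)) =>
      estimateMoment b τ s x.1 i x.2.1 x.2.2 := by
  refine Finset.measurable_sum _ fun a _ => ?_
  refine ((measurable_pi_apply a).comp (measurable_subtype_coe.comp measurable_fst)).mul ?_
  exact ((((measurable_taskEstimate b τ i a).comp (measurable_snd.fst.prodMk
    measurable_snd.snd.snd)).sub ((measurable_actionReward a).comp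
      measurable_snd.snd.fst)).const_mul s).exp

/-- The prior does not depend on the data, so the average over its actions can be taken outside the
expectation over the task and its data set. -/
theorem lintegral_estimateMoment_le (hm : 0 < m) (env : ProbabilityMeasure (BanditTask 𝒜))
    (b : BehaviourPolicies 𝒜 m) {τ s : ℝ} (hτ : 0 < τ) (hs : 0 ≤ s) (P : Policy 𝒜) (i : ℕ)
    (H : Fin i → Dataset 𝒜 m) :
    ∫⁻ x, ENNReal.ofReal (estimateMoment b τ s P i H x) ∂(taskKernel env b i H) ≤
      ENNReal.ofReal (Real.exp (s ^ 2 * (1 + τ) ^ 2 / (8 * m))) := by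
  have hmeas (a : 𝒜) : Measurable fun x : BanditTask 𝒜 × Dataset 𝒜 m =>
      ENNReal.ofReal (Real.exp (s * (taskEstimate b τ i H x.2 a - actionReward x.1 a))) :=
    ENNReal.measurable_ofReal.comp ((((measurable_taskEstimate b τ i a).comp
      (measurable_const.prodMk measurable_snd)).sub ((measurable_actionReward a).comp
      measurable_fst)).const_mul s).exp
  unfold estimateMoment
  simp_rw [ENNReal.ofReal_sum_of_nonneg fun a _ => mul_nonneg (P.2.1 a) (Real.exp_pos _).le,
    ENNReal.ofReal_mul (P.2.1 _)]
  rw [lintegral_finsetSum _ fun a _ => (hmeas a).const_mul _]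
  calc _ ≤ ∑ a, ENNReal.ofReal (P.1 a) *
        ENNReal.ofReal (Real.exp (s ^ 2 * (1 + τ) ^ 2 / (8 * m))) := by
        refine Finset.sum_le_sum fun a _ => ?_
        rw [lintegral_const_mul _ (hmeas a)]
        gcongr
        unfold taskKernel
        rw [Kernel.lintegral_compProd _ _ _ (hmeas a)]
        refine (lintegral_mono fun T =>
          lintegral_exp_taskEstimate_le hm b hτ i T H a hs).trans (le_of_eq ?_)
        simp
    _ = _ := by
        rw [← Finset.sum_mul, ← ENNReal.ofReal_sum_of_nonneg fun a _ => P.2.1 a, P.2.2,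
          ENNReal.ofReal_one, one_mul]

end LifelongBandit

/-! ### The general PAC-Bayes bound -/

/-- An integrable function whose positive part has lower integral at most `c` has integral at most
`c`. -/
theorem integral_le_toReal_of_lintegral_ofReal_le {α : Type*} [MeasurableSpace α] {μ : Measure α}
    {f : α → ℝ} (hf : Integrable f μ) {c : ℝ≥0∞} (hc : c ≠ ∞)
    (h : ∫⁻ x, ENNReal.ofReal (f x) ∂μ ≤ c) : ∫ x, f x ∂μ ≤ c.toReal := by
  rw [integral_eq_lintegral_pos_part_sub_lintegral_neg_part hf]
  linarith [ENNReal.toReal_mono hc h,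
    ENNReal.toReal_nonneg (a := ∫⁻ x, ENNReal.ofReal (-f x) ∂μ)]

/-- The PAC-Bayes bound: a bound on the exponential moment for every parameter gives, with high
probability, a bound on the averages over all posteriors at once. -/
theorem exists_measurableSet_forall_integral_le {Ω Θ : Type*} [MeasurableSpace Ω]
    [MeasurableSpace Θ] (μ : Measure Ω) [IsProbabilityMeasure μ] (π : Measure Θ)
    [IsProbabilityMeasure π] {F : Θ → Ω → ℝ} (hF : Measurable fun x : Θ × Ω => F x.1 x.2) {C : ℝ}
    (hC : ∀ θ ω, |F θ ω| ≤ C) {c : ℝ}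
    (hc : ∀ θ, ∫⁻ ω, ENNReal.ofReal (Real.exp (F θ ω)) ∂μ ≤ ENNReal.ofReal (Real.exp c))
    {δ : ℝ} (hδ : 0 < δ) :
    ∃ E : Set Ω, MeasurableSet E ∧ μ Eᶜ ≤ ENNReal.ofReal δ ∧
      ∀ ω ∈ E, ∀ Q : Measure Θ, IsProbabilityMeasure Q → InformationTheory.klDiv Q π ≠ ∞ →
        ∫ θ, F θ ω ∂Q ≤ (InformationTheory.klDiv Q π).toReal + c + Real.log (1 / δ) := by
  have hexp : Measurable fun x : Θ × Ω => ENNReal.ofReal (Real.exp (F x.1 x.2)) :=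
    ENNReal.measurable_ofReal.comp hF.exp
  have hmeas : Measurable fun ω => ∫⁻ θ, ENNReal.ofReal (Real.exp (F θ ω)) ∂π :=
    Measurable.lintegral_prod_left' hexp
  have hpos : 0 < Real.exp c / δ := by positivity
  -- The event does not mention `Q`, which is why the bound is uniform. The threshold is the one for
  -- which Markov's inequality gives exactly `δ`.
  refine ⟨{ω | ∫⁻ θ, ENNReal.ofReal (Real.exp (F θ ω)) ∂π ≤ ENNReal.ofReal (Real.exp c / δ)},
    measurableSet_le hmeas measurable_const, ?_, ?_⟩
  · calc μ {ω | ∫⁻ θ, ENNReal.ofReal (Real.exp (F θ ω)) ∂π ≤ ENNReal.ofReal (Real.exp c / δ)}ᶜ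
      _ ≤ μ {ω | ENNReal.ofReal (Real.exp c / δ) ≤
          ∫⁻ θ, ENNReal.ofReal (Real.exp (F θ ω)) ∂π} :=
          measure_mono fun ω hω => (not_le.1 (Set.notMem_ofPred_iff.1 hω)).le
      _ ≤ (∫⁻ ω, ∫⁻ θ, ENNReal.ofReal (Real.exp (F θ ω)) ∂π ∂μ) /
          ENNReal.ofReal (Real.exp c / δ) :=
          meas_ge_le_lintegral_div hmeas.aemeasurable (by simpa using hpos) ENNReal.ofReal_ne_top
      _ ≤ ENNReal.ofReal (Real.exp c) / ENNReal.ofReal (Real.exp c / δ) := by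
          gcongr
          -- Tonelli's theorem applies because `π` is fixed independently of the data.
          rw [lintegral_lintegral_swap (by exact (hexp.comp measurable_swap).aemeasurable)]
          exact (lintegral_mono hc).trans (by simp)
      _ = ENNReal.ofReal δ := by
          rw [← ENNReal.ofReal_div_of_pos hpos]
          congr 1
          field_simp
  · intro ω hω Q _ hQ
    have hm : Measurable fun θ => F θ ω := hF.comp measurable_prodMk_right
    have hdv := ofReal_integral_sub_log_integral_exp_le_klDiv Q π hm (fun θ => hC θ ω)
    rw [ENNReal.ofReal_le_iff_le_toReal hQ] at hdv
    have hint : Integrable (fun θ => Real.exp (F θ ω)) π :=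
      Integrable.of_bound hm.exp.aestronglyMeasurable (Real.exp C) (ae_of_all _ fun θ => by
        rw [Real.norm_eq_abs, Real.abs_exp]
        exact Real.exp_le_exp.2 ((le_abs_self _).trans (hC θ ω)))
    have hle : ∫ θ, Real.exp (F θ ω) ∂π ≤ Real.exp c / δ := by
      rw [← ENNReal.ofReal_le_ofReal_iff hpos.le,
        ofReal_integral_eq_lintegral_ofReal hint (ae_of_all _ fun θ => (Real.exp_pos _).le)]
      exact hω
    have hlog := Real.log_le_log (integral_exp_pos hint) hle
    rw [Real.log_div (Real.exp_pos c).ne' hδ.ne', Real.log_exp] at hlog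
    rw [one_div, Real.log_inv]
    linarith

/-! ### Empirical rewards and estimation errors over all tasks -/

namespace LifelongBandit

variable {𝒜 : Type*} [Fintype 𝒜] [MeasurableSpace 𝒜] {m : ℕ}

theorem estimateMoment_pos [DecidableEq 𝒜] (hm : 0 < m) (b : BehaviourPolicies 𝒜 m) {τ s : ℝ}
    (hτ : 0 < τ)
    (hs : 0 ≤ s) (P : Policy 𝒜) (i : ℕ) (H : Fin i → Dataset 𝒜 m)
    (x : BanditTask 𝒜 × Dataset 𝒜 m) : 0 < estimateMoment b τ s P i H x :=
  (Real.exp_pos _).trans_le (estimateMoment_mem_Icc hm b hτ hs P i H x).1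

/-- The clipped empirical multi-task reward of a single prior. -/
noncomputable def priorClippedReward [DecidableEq 𝒜] (b : BehaviourPolicies 𝒜 m)
    (A : LearningAlgorithm 𝒜) (τ : ℝ)
    {n : ℕ} (ω : Fin n → BanditTask 𝒜 × Dataset 𝒜 m) (P : Policy 𝒜) : ℝ :=
  (1 / n) * ∑ i : Fin n, (1 / m) * ∑ j : Fin m,
    ∑ a, (A.posterior (ω i).2 j j.isLt.le P).1 a * clippedEstimate b τ ω i a

theorem measurable_priorClippedReward [DecidableEq 𝒜] (b : BehaviourPolicies 𝒜 m)
    (A : LearningAlgorithm 𝒜) (τ : ℝ)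
    {n : ℕ} (ω : Fin n → BanditTask 𝒜 × Dataset 𝒜 m) :
    Measurable (priorClippedReward b A τ ω) := by
  refine (Finset.measurable_sum _ fun i _ => (Finset.measurable_sum _ fun j _ =>
    Finset.measurable_sum _ fun a _ => Measurable.mul_const ?_ _).const_mul _).const_mul _
  exact (measurable_pi_apply a).comp (measurable_subtype_coe.comp
    ((measurable_posterior A j j.isLt.le).comp measurable_prodMk_left))

theorem priorClippedReward_mem_Icc [DecidableEq 𝒜] (hm : 0 < m) (b : BehaviourPolicies 𝒜 m)
    (A : LearningAlgorithm 𝒜) {τ : ℝ} (hτ : 0 < τ) {n : ℕ} (hn : 0 < n)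
    (ω : Fin n → BanditTask 𝒜 × Dataset 𝒜 m) (P : Policy 𝒜) :
    priorClippedReward b A τ ω P ∈ Set.Icc 0 (1 + τ) :=
  average_mem_Icc hn fun i => average_mem_Icc hm fun _ =>
    Policy.sum_mul_mem_Icc _ fun a => taskEstimate_mem_Icc hm b hτ i (past ω i) (ω i).2 a

/-- The logarithm of the exponential moments of the errors of the clipped reward estimates, summed
over the tasks. -/
noncomputable def logEstimateMoment [DecidableEq 𝒜] (b : BehaviourPolicies 𝒜 m) (τ s : ℝ) {n : ℕ}
    (P : Policy 𝒜)
    (ω : Fin n → BanditTask 𝒜 × Dataset 𝒜 m) : ℝ :=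
  ∑ i : Fin n, Real.log (estimateMoment b τ s P i (past ω i) (ω i))

theorem abs_logEstimateMoment_le [DecidableEq 𝒜] (hm : 0 < m) (b : BehaviourPolicies 𝒜 m) {τ s : ℝ}
    (hτ : 0 < τ)
    (hs : 0 ≤ s) {n : ℕ} (P : Policy 𝒜) (ω : Fin n → BanditTask 𝒜 × Dataset 𝒜 m) :
    |logEstimateMoment b τ s P ω| ≤ n * (s * (1 + τ)) := by
  refine (Finset.abs_sum_le_sum_abs _ _).trans ?_
  refine (Finset.sum_le_sum (g := fun _ => s * (1 + τ)) fun i _ => ?_).trans (by simp)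
  have h := estimateMoment_mem_Icc hm b hτ hs P i (past ω i) (ω i)
  have hpos := estimateMoment_pos hm b hτ hs P i (past ω i) (ω i)
  refine abs_le.2 ⟨?_, (Real.log_le_iff_le_exp hpos).2 h.2⟩
  have h' := (Real.le_log_iff_exp_le hpos).2 h.1
  nlinarith

/-! ### Unconditional rewards and their monotonicity -/

variable [DiscreteMeasurableSpace 𝒜]

theorem integral_mem_Icc {α : Type*} [MeasurableSpace α] (μ : Measure α) [IsProbabilityMeasure μ]
    {f : α → ℝ} (hf : ∀ x, f x ∈ Set.Icc 0 1) : ∫ x, f x ∂μ ∈ Set.Icc 0 1 := by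
  refine ⟨integral_nonneg fun x => (hf x).1, ?_⟩
  have h : ∫ x, f x ∂μ ≤ ∫ _, (1 : ℝ) ∂μ :=
    integral_mono_of_nonneg (ae_of_all _ fun x => (hf x).1) (integrable_const _)
      (ae_of_all _ fun x => (hf x).2)
  simpa using h

/-- Each task is drawn from `env` independently of the past, so its marginal law does not depend on
`i`. This covers the posterior without data, which `MonotoneExpectedReward` leaves out. -/
theorem taskExp_of_task (env : ProbabilityMeasure (BanditTask 𝒜)) (b : BehaviourPolicies 𝒜 m)
    (i : ℕ) {f : BanditTask 𝒜 → ℝ} (hf : Measurable f) (h01 : ∀ T, f T ∈ Set.Icc 0 1) :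
    taskExp env b i (fun x => f x.1) = ∫ T, f T ∂(env : Measure (BanditTask 𝒜)) := by
  have hlast : Measurable fun ω : Fin (i + 1) → BanditTask 𝒜 × Dataset 𝒜 m =>
      f (ω (Fin.last i)).1 := by fun_prop
  have hkernel (H : Fin i → Dataset 𝒜 m) : ∫ x, f x.1 ∂(taskKernel env b i H) =
      ∫ T, f T ∂(env : Measure (BanditTask 𝒜)) := by
    unfold taskKernel
    rw [integral_compProd (Integrable.of_mem_Icc 0 1 (by fun_prop) (ae_of_all _ fun x => h01 x.1))]
    simp
  rw [taskExp, jointLaw, integral_map (measurable_snoc i).aemeasurable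
    hlast.aestronglyMeasurable]
  simp only [Fin.snoc_last]
  rw [Measure.integral_compProd (f := fun x : (Fin i → BanditTask 𝒜 × Dataset 𝒜 m) ×
      (BanditTask 𝒜 × Dataset 𝒜 m) => f x.2.1)
    (Integrable.of_mem_Icc 0 1 (by fun_prop) (ae_of_all _ fun x => h01 x.2.1))]
  simp only [Kernel.comap_apply, hkernel]
  simp

theorem taskExp_averageReward (env : ProbabilityMeasure (BanditTask 𝒜))
    (b : BehaviourPolicies 𝒜 m) (A : LearningAlgorithm 𝒜) (P : Policy 𝒜) (i : ℕ) :
    taskExp env b i (averageReward A P) = (1 / m) * ∑ j : Fin m,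
      taskExp env b i (fun x => policyReward x.1 (A.posterior x.2 j j.isLt.le P)) := by
  unfold taskExp averageReward
  rw [integral_const_mul, integral_finsetSum]
  intro j _
  refine Integrable.of_mem_Icc 0 1 ?_ (ae_of_all _ fun ω => policyReward_mem_Icc _ _)
  exact ((measurable_policyReward_posterior A j j.isLt.le).comp
    (measurable_const.prodMk (measurable_pi_apply (Fin.last i)))).aemeasurable

theorem taskExp_averageReward_le {env : ProbabilityMeasure (BanditTask 𝒜)}
    {b : BehaviourPolicies 𝒜 m} {A : LearningAlgorithm 𝒜} (hmono : MonotoneExpectedReward env b A)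
    (P : Policy 𝒜) {i n : ℕ} (hin : i ≤ n) :
    taskExp env b i (averageReward A P) ≤ taskExp env b n (averageReward A P) := by
  rw [taskExp_averageReward, taskExp_averageReward]
  refine mul_le_mul_of_nonneg_left (Finset.sum_le_sum fun j _ => ?_) (by positivity)
  -- In round zero the posterior is a constant policy, and both sides are equal; from then on the
  -- hypothesis applies.
  obtain hj | hj := Nat.eq_zero_or_pos (j : ℕ)
  · have hpost (x : BanditTask 𝒜 × Dataset 𝒜 m) :
        A.posterior x.2 j j.isLt.le P = A.toFun j (fun k => (Fin.cast hj k).elim0) P := by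
      unfold LearningAlgorithm.posterior
      congr 1
      funext k
      exact (Fin.cast hj k).elim0
    simp only [hpost]
    have hmeas := measurable_policyReward.comp (measurable_id.prodMk
      (measurable_const (a := A.toFun j (fun k => (Fin.cast hj k).elim0) P)))
    exact ((taskExp_of_task env b i hmeas fun T => policyReward_mem_Icc _ _).trans
      (taskExp_of_task env b n hmeas fun T => policyReward_mem_Icc _ _).symm).le
  · obtain ⟨k, rfl⟩ := Nat.exists_eq_add_of_le hin
    exact hmono P j j.isLt.le hj i k

theorem measurable_taskExp_averageReward (env : ProbabilityMeasure (BanditTask 𝒜))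
    (b : BehaviourPolicies 𝒜 m) (A : LearningAlgorithm 𝒜) (i : ℕ) :
    Measurable fun P => taskExp env b i (averageReward A P) :=
  (((measurable_averageReward A).comp (f := fun x : Policy 𝒜 ×
    (Fin (i + 1) → BanditTask 𝒜 × Dataset 𝒜 m) => (x.1, x.2 (Fin.last i)))
    (by fun_prop)).stronglyMeasurable.integral_prod_right').measurable

theorem measurable_integral_taskKernel (env : ProbabilityMeasure (BanditTask 𝒜))
    (b : BehaviourPolicies 𝒜 m) (A : LearningAlgorithm 𝒜) (i : ℕ) :
    Measurable fun x : Policy 𝒜 × (Fin i → Dataset 𝒜 m) =>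
      ∫ y, averageReward A x.1 y ∂(taskKernel env b i x.2) :=
  (StronglyMeasurable.integral_kernel_prod_right'
    (κ := (taskKernel env b i).comap (Prod.snd : Policy 𝒜 × (Fin i → Dataset 𝒜 m) → _)
      measurable_snd)
    (f := fun x : (Policy 𝒜 × (Fin i → Dataset 𝒜 m)) × (BanditTask 𝒜 × Dataset 𝒜 m) =>
      averageReward A x.1.1 x.2)
    ((measurable_averageReward A).comp
      (measurable_fst.fst.prodMk measurable_snd)).stronglyMeasurable).measurable

/-! ### Conditional rewards and their deviation -/

/-- The difference between the average reward and its conditional expectation, summed over the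
tasks. -/
noncomputable def rewardDeviation (env : ProbabilityMeasure (BanditTask 𝒜))
    (b : BehaviourPolicies 𝒜 m) (A : LearningAlgorithm 𝒜) {n : ℕ} (P : Policy 𝒜)
    (ω : Fin n → BanditTask 𝒜 × Dataset 𝒜 m) : ℝ :=
  ∑ i : Fin n, (averageReward A P (ω i) - taskCondExp env b ω i (averageReward A P))

theorem measurable_taskCondExp_averageReward (env : ProbabilityMeasure (BanditTask 𝒜))
    (b : BehaviourPolicies 𝒜 m) (A : LearningAlgorithm 𝒜) {n : ℕ} (i : Fin n) :
    Measurable fun x : Policy 𝒜 × (Fin n → BanditTask 𝒜 × Dataset 𝒜 m) =>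
      taskCondExp env b x.2 i (averageReward A x.1) :=
  (measurable_integral_taskKernel env b A i).comp
    (f := fun x : Policy 𝒜 × (Fin n → BanditTask 𝒜 × Dataset 𝒜 m) => (x.1, past x.2 i))
    (by fun_prop)

theorem measurable_averageReward_apply (A : LearningAlgorithm 𝒜) {n : ℕ} (i : Fin n) :
    Measurable fun x : Policy 𝒜 × (Fin n → BanditTask 𝒜 × Dataset 𝒜 m) =>
      averageReward A x.1 (x.2 i) :=
  (measurable_averageReward A).comp (f := fun x : Policy 𝒜 ×
    (Fin n → BanditTask 𝒜 × Dataset 𝒜 m) => (x.1, x.2 i)) (by fun_prop)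

theorem measurable_rewardDeviation (env : ProbabilityMeasure (BanditTask 𝒜))
    (b : BehaviourPolicies 𝒜 m) (A : LearningAlgorithm 𝒜) (n : ℕ) :
    Measurable fun x : Policy 𝒜 × (Fin n → BanditTask 𝒜 × Dataset 𝒜 m) =>
      rewardDeviation env b A x.1 x.2 :=
  Finset.measurable_sum _ fun i _ => (measurable_averageReward_apply A i).sub
    (measurable_taskCondExp_averageReward env b A i)

theorem abs_rewardDeviation_le (hm : 0 < m) (env : ProbabilityMeasure (BanditTask 𝒜))
    (b : BehaviourPolicies 𝒜 m) (A : LearningAlgorithm 𝒜) {n : ℕ} (P : Policy 𝒜)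
    (ω : Fin n → BanditTask 𝒜 × Dataset 𝒜 m) : |rewardDeviation env b A P ω| ≤ n := by
  refine (Finset.abs_sum_le_sum_abs _ _).trans ?_
  refine (Finset.sum_le_sum (g := fun _ => (1 : ℝ)) fun i _ => ?_).trans (by simp)
  have h1 := averageReward_mem_Icc hm A P (ω i)
  have h2 : taskCondExp env b ω i (averageReward A P) ∈ Set.Icc 0 1 :=
    integral_mem_Icc _ (averageReward_mem_Icc hm A P)
  exact abs_le.2 ⟨by linarith [h1.1, h2.2], by linarith [h1.2, h2.1]⟩

/-- The summands are martingale differences. Hoeffding's lemma is applied to each under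
`taskKernel`, with the range `[0, 1]` and `M` the conditional mean itself. -/
theorem lintegral_exp_rewardDeviation_le (hm : 0 < m) (env : ProbabilityMeasure (BanditTask 𝒜))
    (b : BehaviourPolicies 𝒜 m) (A : LearningAlgorithm 𝒜) (n : ℕ) (P : Policy 𝒜) {s : ℝ}
    (hs : 0 ≤ s) :
    ∫⁻ ω, ENNReal.ofReal (Real.exp (s * rewardDeviation env b A P ω)) ∂(jointLaw env b n) ≤
      ENNReal.ofReal (Real.exp (n * (s ^ 2 / 8))) := by
  have havg : Measurable fun x : BanditTask 𝒜 × Dataset 𝒜 m => averageReward A P x :=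
    (measurable_averageReward (m := m) A).comp
      (f := fun x : BanditTask 𝒜 × Dataset 𝒜 m => (P, x)) measurable_prodMk_left
  have hcond (i : ℕ) : Measurable fun H : Fin i → Dataset 𝒜 m =>
      ∫ y, averageReward A P y ∂(taskKernel env b i H) :=
    (measurable_integral_taskKernel env b A i).comp measurable_prodMk_left
  have hmeas (i : ℕ) : Measurable fun x : (Fin i → Dataset 𝒜 m) × (BanditTask 𝒜 × Dataset 𝒜 m) =>
      ENNReal.ofReal (Real.exp (s * (averageReward A P x.2 -
        ∫ y, averageReward A P y ∂(taskKernel env b i x.1)))) := by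
    exact ENNReal.measurable_ofReal.comp (((havg.comp (f := fun x : (Fin i → Dataset 𝒜 m) ×
      (BanditTask 𝒜 × Dataset 𝒜 m) => x.2) measurable_snd).sub
        ((hcond i).comp measurable_fst)).const_mul s).exp
  have key := lintegral_prod_jointLaw_le env b
    (g := fun i H x => ENNReal.ofReal (Real.exp (s * (averageReward A P x -
      ∫ y, averageReward A P y ∂(taskKernel env b i H)))))
    hmeas
    (c := ENNReal.ofReal (Real.exp (s ^ 2 * 1 ^ 2 / 8)))
    (fun i H => lintegral_exp_mul_sub_le (taskKernel env b i H) havg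
      (fun x => (averageReward_mem_Icc hm A P x).1) (fun x => (averageReward_mem_Icc hm A P x).2)
      le_rfl hs) n
  refine (le_of_eq ?_).trans (key.trans (le_of_eq ?_))
  · refine lintegral_congr fun ω => ?_
    rw [← ENNReal.ofReal_prod_of_nonneg fun _ _ => (Real.exp_pos _).le, ← Real.exp_sum,
      ← Finset.mul_sum]
    rfl
  · rw [← ENNReal.ofReal_pow (Real.exp_pos _).le, ← Real.exp_nat_mul, one_pow, mul_one]

/-- The average over the priors of the conditional minus the unconditional rewards is bounded by
the dependence term. -/
theorem le_dependenceTerm (hm : 0 < m) (env : ProbabilityMeasure (BanditTask 𝒜))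
    (b : BehaviourPolicies 𝒜 m) (A : LearningAlgorithm 𝒜) {n : ℕ} (hn : 0 < n)
    (ω : Fin n → BanditTask 𝒜 × Dataset 𝒜 m) (P : Policy 𝒜) :
    (1 / n) * ∑ i : Fin n, taskCondExp env b ω i (averageReward A P) -
      (1 / n) * ∑ i : Fin n, taskExp env b i (averageReward A P) ≤ dependenceTerm env b A ω := by
  -- A real supremum dominates its terms only if the family is bounded above; here `1` is a bound,
  -- both averages being in `[0, 1]`.
  refine le_ciSup (f := fun P : Policy 𝒜 =>
    (1 / n) * ∑ i : Fin n, taskCondExp env b ω i (averageReward A P) -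
      (1 / n) * ∑ i : Fin n, taskExp env b i (averageReward A P)) ⟨1, ?_⟩ P
  rintro _ ⟨P, rfl⟩
  have h1 := average_mem_Icc hn (f := fun i => taskCondExp env b ω i (averageReward A P))
    fun i => integral_mem_Icc _ (averageReward_mem_Icc hm A P)
  have h2 := average_mem_Icc hn (f := fun i : Fin n => taskExp env b i (averageReward A P))
    fun i => integral_mem_Icc _ fun _ => averageReward_mem_Icc hm A P _
  linarith [h1.2, h2.1]

/-! ### From priors to posteriors -/

variable [DecidableEq 𝒜]

theorem measurable_logEstimateMoment (b : BehaviourPolicies 𝒜 m) (τ s : ℝ) (n : ℕ) :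
    Measurable fun x : Policy 𝒜 × (Fin n → BanditTask 𝒜 × Dataset 𝒜 m) =>
      logEstimateMoment b τ s x.1 x.2 :=
  Finset.measurable_sum _ fun i _ => ((measurable_estimateMoment b τ s i).comp
    (f := fun x : Policy 𝒜 × (Fin n → BanditTask 𝒜 × Dataset 𝒜 m) =>
      (x.1, (past x.2 i, x.2 i))) (by fun_prop)).log

/-- Exponentiating the sum of logarithms gives back the product of the moments, which is integrated
task by task. -/
theorem lintegral_exp_logEstimateMoment_le (hm : 0 < m) (env : ProbabilityMeasure (BanditTask 𝒜))
    (b : BehaviourPolicies 𝒜 m) {τ s : ℝ} (hτ : 0 < τ) (hs : 0 ≤ s) (n : ℕ) (P : Policy 𝒜) :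
    ∫⁻ ω, ENNReal.ofReal (Real.exp (logEstimateMoment b τ s P ω)) ∂(jointLaw env b n) ≤
      ENNReal.ofReal (Real.exp (n * (s ^ 2 * (1 + τ) ^ 2 / (8 * m)))) := by
  have key := lintegral_prod_jointLaw_le env b
    (g := fun i H x => ENNReal.ofReal (estimateMoment b τ s P i H x))
    (fun i => ENNReal.measurable_ofReal.comp ((measurable_estimateMoment b τ s i).comp
      measurable_prodMk_left))
    (fun i H => lintegral_estimateMoment_le hm env b hτ hs P i H) n
  refine (le_of_eq ?_).trans (key.trans (le_of_eq ?_))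
  · refine lintegral_congr fun ω => ?_
    have hpos (i : Fin n) := estimateMoment_pos hm b hτ hs P i (past ω i) (ω i)
    rw [← ENNReal.ofReal_prod_of_nonneg fun i _ => (hpos i).le, logEstimateMoment, Real.exp_sum]
    simp_rw [Real.exp_log (hpos _)]
  · rw [← ENNReal.ofReal_pow (Real.exp_pos _).le, ← Real.exp_nat_mul]

/-- Donsker-Varadhan on the actions. It holds for every `q` at a fixed outcome, so `q` may depend on
the same data as the estimate. -/
theorem ofReal_estimate_sub_log_le_klDiv (hm : 0 < m) (b : BehaviourPolicies 𝒜 m) {τ s : ℝ}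
    (hτ : 0 < τ) (hs : 0 ≤ s) {n : ℕ} (ω : Fin n → BanditTask 𝒜 × Dataset 𝒜 m) (i : Fin n)
    (q P : Policy 𝒜) :
    ENNReal.ofReal (s * (∑ a, q.1 a * clippedEstimate b τ ω i a - policyReward (ω i).1 q) -
      Real.log (estimateMoment b τ s P i (past ω i) (ω i))) ≤
      InformationTheory.klDiv q.toMeasure P.toMeasure := by
  have h := ofReal_integral_sub_log_integral_exp_le_klDiv q.toMeasure P.toMeasure
    (f := fun a => s * (taskEstimate b τ i (past ω i) (ω i).2 a - actionReward (ω i).1 a))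
    Measurable.of_discrete (C := s * (1 + τ)) fun a => by
      have h1 := taskEstimate_mem_Icc hm b hτ i (past ω i) (ω i).2 a
      have h2 := actionReward_nonneg (ω i).1 a
      have h3 := actionReward_le_one (ω i).1 a
      rw [abs_mul, abs_of_nonneg hs]
      exact mul_le_mul_of_nonneg_left
        (abs_le.2 ⟨by linarith [h1.1], by linarith [h1.2]⟩) hs
  rw [integral_toMeasure, integral_toMeasure] at h
  refine (le_of_eq ?_).trans h
  congr 2
  rw [policyReward, ← Finset.sum_sub_distrib, Finset.mul_sum]
  refine Finset.sum_congr rfl fun a _ => ?_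
  rw [← mul_sub, mul_left_comm]
  rfl

/-- The change of measure from the priors to the posteriors, summed over all tasks and rounds. -/
theorem ofReal_clippedReward_sub_le_sum_klDiv (hm : 0 < m)
    (b : BehaviourPolicies 𝒜 m) (A : LearningAlgorithm 𝒜) {τ s : ℝ} (hτ : 0 < τ) (hs : 0 ≤ s)
    {n : ℕ} (hn : 0 < n) (ω : Fin n → BanditTask 𝒜 × Dataset 𝒜 m) (P : Policy 𝒜) :
    ENNReal.ofReal (s * n * m * (priorClippedReward b A τ ω P -
      (1 / n) * ∑ i, averageReward A P (ω i)) - m * logEstimateMoment b τ s P ω) ≤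
      ∑ i : Fin n, ∑ j : Fin m, InformationTheory.klDiv
        (A.posterior (ω i).2 j j.isLt.le P).toMeasure P.toMeasure := by
  have hn' : (0 : ℝ) < n := Nat.cast_pos.2 hn
  have hm' : (0 : ℝ) < m := Nat.cast_pos.2 hm
  have hle : ∀ {k : ℕ} (f : Fin k → ℝ), ENNReal.ofReal (∑ i, f i) ≤ ∑ i, ENNReal.ofReal (f i) :=
    fun f => Finset.le_sum_of_subadditive _ ENNReal.ofReal_zero.le
      (fun _ _ => ENNReal.ofReal_add_le) _ _
  calc _ = ENNReal.ofReal (∑ i : Fin n, ∑ j : Fin m,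
        (s * (∑ a, (A.posterior (ω i).2 j j.isLt.le P).1 a * clippedEstimate b τ ω i a -
          policyReward (ω i).1 (A.posterior (ω i).2 j j.isLt.le P)) -
          Real.log (estimateMoment b τ s P i (past ω i) (ω i)))) := by
        congr 1
        unfold priorClippedReward averageReward logEstimateMoment
        -- The log-moment of a task is the same for all its rounds, hence the factor `m` in front of
        -- `logEstimateMoment`.
        simp only [Finset.sum_sub_distrib, ← Finset.mul_sum, Finset.sum_const, Finset.card_univ,
          Fintype.card_fin, nsmul_eq_mul]
        field_simp
    _ ≤ _ := (hle _).trans <| Finset.sum_le_sum fun i _ => (hle _).trans <|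
        Finset.sum_le_sum fun j _ => ofReal_estimate_sub_log_le_klDiv hm b hτ hs ω i _ P

end LifelongBandit

/-! ### The deterministic part of the bound -/

namespace LifelongBandit

variable {𝒜 : Type*} [Fintype 𝒜] [DecidableEq 𝒜] [MeasurableSpace 𝒜] [DiscreteMeasurableSpace 𝒜]
  {m : ℕ}

/-- The deterministic part of the bound: given the two changes of measure for a fixed outcome and a
fixed hyperposterior, the transfer reward is bounded below. -/
theorem transferReward_ge {n : ℕ} (hn : 0 < n) (hm : 0 < m)
    {env : ProbabilityMeasure (BanditTask 𝒜)} {b : BehaviourPolicies 𝒜 m}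
    {A : LearningAlgorithm 𝒜} (hmono : MonotoneExpectedReward env b A) {lam₁ lam₂ τ : ℝ}
    (hlam₁ : 0 < lam₁) (hlam₂ : 0 < lam₂) (hτ : 0 < τ)
    (ω : Fin n → BanditTask 𝒜 × Dataset 𝒜 m) (Q : ProbabilityMeasure (Policy 𝒜))
    (hpost : posteriorKL A ω Q ≠ ∞) {B₁ B₂ : ℝ}
    (h₁ : ∫ P, lam₁ / n * rewardDeviation env b A P ω ∂(Q : Measure (Policy 𝒜)) ≤ B₁)
    (h₂ : ∫ P, logEstimateMoment b τ lam₂ P ω ∂(Q : Measure (Policy 𝒜)) ≤ B₂) :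
    clippedReward b A τ ω Q - 1 / lam₁ * B₁ - 1 / (n * lam₂) * B₂ -
      1 / (n * m * lam₂) * (posteriorKL A ω Q).toReal - dependenceTerm env b A ω ≤
      transferReward env b A n Q := by
  have hn' : (0 : ℝ) < n := Nat.cast_pos.2 hn
  have hm' : (0 : ℝ) < m := Nat.cast_pos.2 hm
  have hU : Integrable (fun P => priorClippedReward b A τ ω P) (Q : Measure (Policy 𝒜)) :=
    Integrable.of_mem_Icc 0 (1 + τ) (measurable_priorClippedReward b A τ ω).aemeasurable
      (ae_of_all _ fun P => priorClippedReward_mem_Icc hm b A hτ hn ω P)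
  have hV : Integrable (fun P => (1 / (n : ℝ)) * ∑ i, averageReward A P (ω i))
      (Q : Measure (Policy 𝒜)) :=
    Integrable.of_mem_Icc 0 1 ((Finset.measurable_sum _ fun i _ =>
      (measurable_averageReward_apply A i).comp measurable_prodMk_right).const_mul _).aemeasurable
      (ae_of_all _ fun P => average_mem_Icc hn fun i => averageReward_mem_Icc hm A P (ω i))
  have hD : Integrable (fun P => rewardDeviation env b A P ω) (Q : Measure (Policy 𝒜)) :=
    Integrable.of_bound ((measurable_rewardDeviation env b A n).comp
      measurable_prodMk_right).aestronglyMeasurable n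
      (ae_of_all _ fun P => abs_rewardDeviation_le hm env b A P ω)
  have hF : Integrable (fun P => logEstimateMoment b τ lam₂ P ω) (Q : Measure (Policy 𝒜)) :=
    Integrable.of_bound ((measurable_logEstimateMoment b τ lam₂ n).comp
      measurable_prodMk_right).aestronglyMeasurable (n * (lam₂ * (1 + τ)))
      (ae_of_all _ fun P => abs_logEstimateMoment_le hm b hτ hlam₂.le P ω)
  have hY : Integrable (fun P => taskExp env b n (averageReward A P)) (Q : Measure (Policy 𝒜)) :=
    Integrable.of_mem_Icc 0 1 (measurable_taskExp_averageReward env b A n).aemeasurable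
      (ae_of_all _ fun P => integral_mem_Icc _ fun _ => averageReward_mem_Icc hm A P _)
  -- Removing the deviation leaves the conditional expectations, the dependence term leads to the
  -- unconditional ones, and monotonicity to the next task; all this holds for each prior and is
  -- then integrated.
  have htransfer : ∫ P, (1 / (n : ℝ)) * ∑ i, averageReward A P (ω i) ∂(Q : Measure (Policy 𝒜)) -
      1 / n * ∫ P, rewardDeviation env b A P ω ∂(Q : Measure (Policy 𝒜)) -
      dependenceTerm env b A ω ≤ transferReward env b A n Q := by
    have hle : ∫ P, ((1 / (n : ℝ)) * ∑ i, averageReward A P (ω i) -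
        1 / n * rewardDeviation env b A P ω - dependenceTerm env b A ω) ∂(Q : Measure (Policy 𝒜)) ≤
        transferReward env b A n Q := by
      refine integral_mono ((hV.sub (hD.const_mul _)).sub (integrable_const _)) hY fun P => ?_
      have hdep := le_dependenceTerm hm env b A hn ω P
      have hX : (1 / (n : ℝ)) * ∑ i : Fin n, taskExp env b i (averageReward A P) ≤
          taskExp env b n (averageReward A P) :=
        (average_mem_Icc hn (c := 0) (f := fun i : Fin n => taskExp env b i (averageReward A P))
          fun i => ⟨(integral_mem_Icc _ fun _ => averageReward_mem_Icc hm A P _).1,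
            taskExp_averageReward_le hmono P i.isLt.le⟩).2
      simp only [rewardDeviation, Finset.sum_sub_distrib]
      linarith
    rwa [integral_sub (by exact hV.sub (hD.const_mul _)) (integrable_const _),
      integral_sub hV (by exact hD.const_mul _),
      integral_const_mul _ (fun P => rewardDeviation env b A P ω), integral_const, probReal_univ,
      one_smul] at hle
  -- Monotonicity of the lower integral asks for no measurability of the divergences in the prior.
  have hpostle := integral_le_toReal_of_lintegral_ofReal_le
    (((hU.sub hV).const_mul (lam₂ * n * m)).sub (hF.const_mul (m : ℝ))) hpost
    (lintegral_mono fun P => ofReal_clippedReward_sub_le_sum_klDiv hm b A hτ hlam₂.le hn ω P)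
  have hsplit : ∫ P, (lam₂ * n * m * (priorClippedReward b A τ ω P -
      (1 / (n : ℝ)) * ∑ i, averageReward A P (ω i)) - m * logEstimateMoment b τ lam₂ P ω)
      ∂(Q : Measure (Policy 𝒜)) =
      lam₂ * n * m * (clippedReward b A τ ω Q -
        ∫ P, (1 / (n : ℝ)) * ∑ i, averageReward A P (ω i) ∂(Q : Measure (Policy 𝒜))) -
      m * ∫ P, logEstimateMoment b τ lam₂ P ω ∂(Q : Measure (Policy 𝒜)) := by
    rw [integral_sub (by exact (hU.sub hV).const_mul _) (hF.const_mul _), integral_const_mul,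
      integral_const_mul, integral_sub hU hV]
    rfl
  have hpostle' := hsplit.symm.le.trans hpostle
  rw [integral_const_mul] at h₁
  set U := clippedReward b A τ ω Q
  set V := ∫ P, (1 / (n : ℝ)) * ∑ i, averageReward A P (ω i) ∂(Q : Measure (Policy 𝒜))
  set D := ∫ P, rewardDeviation env b A P ω ∂(Q : Measure (Policy 𝒜))
  set F := ∫ P, logEstimateMoment b τ lam₂ P ω ∂(Q : Measure (Policy 𝒜))
  set K := (posteriorKL A ω Q).toReal
  have e₁ : 1 / n * D ≤ 1 / lam₁ * B₁ :=
    calc 1 / n * D = 1 / lam₁ * (lam₁ / n * D) := by field_simp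
      _ ≤ _ := by gcongr
  have e₂ : U - V ≤ 1 / (n * m * lam₂) * K + 1 / (n * lam₂) * B₂ :=
    calc U - V = 1 / (n * m * lam₂) * (lam₂ * n * m * (U - V) - m * F) + 1 / (n * lam₂) * F := by
          field_simp
          ring
      _ ≤ _ := by gcongr
  linarith

end LifelongBandit

/-! ### The bound with high probability -/

theorem EReal.coe_sub_mul_coe_ennreal_of_eq_top {x c : ℝ} (hc : 0 < c) {K : ℝ≥0∞} (hK : K = ∞) :
    (x : EReal) - (c : EReal) * (K : EReal) = ⊥ := by
  rw [hK, EReal.coe_ennreal_top, EReal.coe_mul_top_of_pos hc, EReal.sub_top]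

theorem theorem3 {𝒜 : Type*} [Fintype 𝒜] [DecidableEq 𝒜] [MeasurableSpace 𝒜]
    [DiscreteMeasurableSpace 𝒜] {n m : ℕ} (hn : 0 < n) (hm : 0 < m)
    (env : ProbabilityMeasure (BanditTask 𝒜)) (b : BehaviourPolicies 𝒜 m) (A : LearningAlgorithm 𝒜)
    (hmono : MonotoneExpectedReward env b A)
    (hyperprior : ProbabilityMeasure (Policy 𝒜))
    {lam₁ lam₂ τ δ : ℝ} (hlam₁ : 0 < lam₁) (hlam₂ : 0 < lam₂)
    (hτ : 0 < τ) (hδ : 0 < δ) (hδ1 : δ ≤ 1) :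
    ∃ E : Set (Fin n → BanditTask 𝒜 × Dataset 𝒜 m), MeasurableSet E ∧
      ENNReal.ofReal (1 - δ) ≤ jointLaw env b n E ∧
      ∀ ω ∈ E, ∀ Q : ProbabilityMeasure (Policy 𝒜),
        (transferReward env b A n Q : EReal) ≥
          (clippedReward b A τ ω Q : EReal)
          - ((1 / lam₁ + 1 / (n * lam₂) : ℝ) : EReal)
              * (InformationTheory.klDiv (Q : Measure (Policy 𝒜)) hyperprior : EReal)
          - ((1 / (n * m * lam₂) : ℝ) : EReal) * (posteriorKL A ω Q : EReal)
          - ((dependenceTerm env b A ω + lam₁ / (8 * n) + lam₂ * (1 + τ) ^ 2 / (8 * m)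
              + (1 / lam₁) * Real.log (2 / δ)
              + (1 / (n * lam₂)) * Real.log (2 * m / δ) : ℝ) : EReal) := by
  have hn' : (0 : ℝ) < n := Nat.cast_pos.2 hn
  have hm' : (1 : ℝ) ≤ m := Nat.one_le_cast.2 hm
  have hs : 0 ≤ lam₁ / n := by positivity
  obtain ⟨E₁, hE₁, hμ₁, h₁⟩ := exists_measurableSet_forall_integral_le (jointLaw env b n)
    (hyperprior : Measure (Policy 𝒜)) (F := fun P ω => lam₁ / n * rewardDeviation env b A P ω)
    ((measurable_rewardDeviation env b A n).const_mul _) (C := lam₁ / n * n)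
    (fun P ω => by
      rw [abs_mul, abs_of_nonneg hs]
      exact mul_le_mul_of_nonneg_left (abs_rewardDeviation_le hm env b A P ω) hs)
    (fun P => lintegral_exp_rewardDeviation_le hm env b A n P hs) (half_pos hδ)
  obtain ⟨E₂, hE₂, hμ₂, h₂⟩ := exists_measurableSet_forall_integral_le (jointLaw env b n)
    (hyperprior : Measure (Policy 𝒜)) (F := fun P ω => logEstimateMoment b τ lam₂ P ω)
    (measurable_logEstimateMoment b τ lam₂ n)
    (fun P ω => abs_logEstimateMoment_le hm b hτ hlam₂.le P ω)
    (fun P => lintegral_exp_logEstimateMoment_le hm env b hτ hlam₂.le n P) (half_pos hδ)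
  refine ⟨E₁ ∩ E₂, hE₁.inter hE₂, ?_, fun ω hω Q => ?_⟩
  · have hcompl : jointLaw env b n (E₁ ∩ E₂)ᶜ ≤ ENNReal.ofReal δ := by
      rw [Set.compl_inter]
      refine (measure_union_le _ _).trans ((add_le_add hμ₁ hμ₂).trans (le_of_eq ?_))
      rw [← ENNReal.ofReal_add (half_pos hδ).le (half_pos hδ).le, add_halves]
    rw [ENNReal.ofReal_sub _ hδ.le, ENNReal.ofReal_one, tsub_le_iff_right]
    calc (1 : ℝ≥0∞) = jointLaw env b n (E₁ ∩ E₂) + jointLaw env b n (E₁ ∩ E₂)ᶜ := by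
          rw [measure_add_measure_compl (hE₁.inter hE₂), measure_univ]
      _ ≤ _ := by gcongr
  · by_cases hK : InformationTheory.klDiv (Q : Measure (Policy 𝒜)) hyperprior = ∞
    · rw [EReal.coe_sub_mul_coe_ennreal_of_eq_top (by positivity) hK]
      simp
    by_cases hP : posteriorKL A ω Q = ∞
    · lift InformationTheory.klDiv (Q : Measure (Policy 𝒜)) hyperprior to NNReal using hK with K
      rw [← EReal.coe_ennreal_toReal ENNReal.coe_ne_top, ← EReal.coe_mul, ← EReal.coe_sub,
        EReal.coe_sub_mul_coe_ennreal_of_eq_top (by positivity) hP]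
      simp
    have key := transferReward_ge hn hm hmono hlam₁ hlam₂ hτ ω Q hP
      (h₁ ω hω.1 Q inferInstance hK) (h₂ ω hω.2 Q inferInstance hK)
    rw [one_div_div] at key
    -- The argument gives `2 / δ` in both logarithms; the stated `2 * m / δ` is weaker since `m ≥
    -- 1`.
    have hlog : 1 / (n * lam₂) * Real.log (2 / δ) ≤ 1 / (n * lam₂) * Real.log (2 * m / δ) := by
      gcongr
      linarith
    have e₁ : 1 / lam₁ * (n * ((lam₁ / n) ^ 2 / 8)) = lam₁ / (8 * n) := by
      field_simp
    have e₂ : 1 / (n * lam₂) * (n * (lam₂ ^ 2 * (1 + τ) ^ 2 / (8 * m))) =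
        lam₂ * (1 + τ) ^ 2 / (8 * m) := by
      field_simp
    rw [mul_add, mul_add, e₁, mul_add, mul_add, e₂] at key
    rw [← EReal.coe_ennreal_toReal hK, ← EReal.coe_ennreal_toReal hP]
    simp only [← EReal.coe_mul, ← EReal.coe_sub, ge_iff_le, EReal.coe_le_coe_iff]
    linarith
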